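/- For $n\ge 1$ let $\Phi_n(x)=\sum_m a_n(m)x^m$ be the $n$-th cyclotomic polynomial and let $\Psi_n(x)=1/\Phi_n(x)=\sum_{m\ge 0}c_n(m)x^m$ (formal power series). Put $$A_n=\max_m|a_n(m)|,\qquad S_n=\sum_{m=0}^{\varphi(n)}|a_n(m)|,\qquad C_n=\max_m|c_n(m)|.$$ For primes $p_1,\ldots,p_k$ put $M_k=\prod_{i=1}^{k-2}p_i^{2^{k-i-1}-1}$ (so $M_k=1$ for $k\le 2$). Let $\varepsilon_k$ (respectively $\varepsilon_k^{inv}$) be the smallest positive real number such that $A_{p_1\cdots p_k}\le\varepsilon_kM_k$ (respectively $C_{p_1\cdots p_k}\le\varepsilon_k^{inv}M_k$) holds for all distinct odd primes $p_1,\ldots,p_k$. Let $$d=\sup_{p,q,r}\frac{S_{pqr}}{p^2qr},\qquad \rho=\prod_{i=0}^{\infty}\left(\frac{2i+5}{2i+6}\right)^{1/2^i},\qquad C=\left(\tfrac34\,\varepsilon_3^{3/2}\,d\,\rho^{1/4}\right)^{1/32},$$ the supremum being over all triples of distinct odd primes $p,q,r$. Then the constants $\varepsilon_3$, $d$ and all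 $\varepsilon_k^{inv}$ are well defined (the smallest positive reals exist and the supremum is finite), and, as $k\to\infty$, $$\log\varepsilon_k^{inv}\le 2^k\log(C+o(1)).$$ -/

import Mathlib

open Filter Topology

noncomputable section

/-- The coefficient `a_n(m)` of `x ^ m` in the `n`-th cyclotomic polynomial `Φ_n`. -/
def cyclotomicCoeff (n m : ℕ) : ℝ := (Polynomial.cyclotomic n ℝ).coeff m

/-- The formal power series `Ψ_n(x) = 1 / Φ_n(x)`. The constant term of `Φ_n` is `±1`,
so this is the genuine inverse. -/
def Psi (n : ℕ) : PowerSeries ℝ := (Polynomial.cyclotomic n ℝ : PowerSeries ℝ)⁻¹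

/-- The coefficient `c_n(m)` of `x ^ m` in `Ψ_n`. -/
def inverseCyclotomicCoeff (n m : ℕ) : ℝ := PowerSeries.coeff m (Psi n)

/-- `A_n = max_m |a_n(m)|`. -/
def heightA (n : ℕ) : ℝ := ⨆ m : ℕ, |cyclotomicCoeff n m|

/-- `S_n = ∑_{m = 0}^{φ(n)} |a_n(m)|`. -/
def lengthS (n : ℕ) : ℝ := ∑ m ∈ Finset.range (Nat.totient n + 1), |cyclotomicCoeff n m|

/-- `C_n = max_m |c_n(m)|` (for `n ≥ 1` the sequence `c_n` is periodic in `m`, so the supremum is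
a maximum). -/
def heightC (n : ℕ) : ℝ := ⨆ m : ℕ, |inverseCyclotomicCoeff n m|

/-- `p 1, …, p k` are distinct odd primes. -/
def DistinctOddPrimes (k : ℕ) (p : ℕ → ℕ) : Prop :=
  (∀ i ∈ Set.Icc 1 k, (p i).Prime ∧ Odd (p i)) ∧ Set.InjOn p (Set.Icc 1 k)

/-- The product `p_1 ⋯ p_k`. -/
def primeProd (k : ℕ) (p : ℕ → ℕ) : ℕ := ∏ i ∈ Finset.Icc 1 k, p i

/-- `M_k = ∏_{i = 1}^{k - 2} p_i ^ (2 ^ (k - i - 1) - 1)`, which is `1` for `k ≤ 2`. -/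
def boundM (k : ℕ) (p : ℕ → ℕ) : ℕ := ∏ i ∈ Finset.Icc 1 (k - 2), p i ^ (2 ^ (k - i - 1) - 1)

/-- The positive reals `c` such that `H (p_1 ⋯ p_k) ≤ c * M_k` for all distinct odd primes
`p_1, …, p_k`. -/
def admissibleConstants (H : ℕ → ℝ) (k : ℕ) : Set ℝ :=
  {c | 0 < c ∧ ∀ p : ℕ → ℕ, DistinctOddPrimes k p → H (primeProd k p) ≤ c * (boundM k p : ℝ)}

/-- `ε_k`: the smallest positive real with `A_{p_1 ⋯ p_k} ≤ ε_k M_k`. -/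
def eps (k : ℕ) : ℝ := sInf (admissibleConstants heightA k)

/-- `ε_k^{inv}`: the smallest positive real with `C_{p_1 ⋯ p_k} ≤ ε_k^{inv} M_k`. -/
def epsInv (k : ℕ) : ℝ := sInf (admissibleConstants heightC k)

/-- The ratios `S_{pqr} / (p ^ 2 q r)` over all triples of distinct odd primes `p, q, r`. -/
def ternaryRatios : Set ℝ :=
  {t | ∃ p q r : ℕ, p.Prime ∧ q.Prime ∧ r.Prime ∧ Odd p ∧ Odd q ∧ Odd r ∧
    p ≠ q ∧ p ≠ r ∧ q ≠ r ∧ t = lengthS (p * q * r) / ((p : ℝ) ^ 2 * q * r)}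

/-- `d = sup_{p,q,r} S_{pqr} / (p ^ 2 q r)`. -/
def constD : ℝ := sSup ternaryRatios

/-- `ρ = ∏_{i = 0}^∞ ((2 i + 5) / (2 i + 6)) ^ (1 / 2 ^ i)`. -/
def constRho : ℝ := ∏' i : ℕ, ((2 * (i : ℝ) + 5) / (2 * (i : ℝ) + 6)) ^ ((1 : ℝ) / 2 ^ i)

/-- `C = ((3 / 4) ε_3 ^ (3 / 2) d ρ ^ (1 / 4)) ^ (1 / 32)`. -/
def constC : ℝ :=
  (3 / 4 * eps 3 ^ ((3 : ℝ) / 2) * constD * constRho ^ ((1 : ℝ) / 4)) ^ ((1 : ℝ) / 32)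

end

/-! Write S, A for the length and height of Φ_n, and G for the length of the cofactor (x^n - 1)/Φ_n,
whose coefficients repeat periodically, up to sign, in 1/Φ_n. For a prime p not dividing n, two
identities drive everything: the cofactor of np is Φ_n(x) times the cofactor of n at x^p, and
(x^(np) - 1) Φ_(np) is a geometric sum in x^n times Φ_n(x^p) times the cofactor of n. Taking norms
gives G_(np) ≤ S_n G_n, S_(np) ≤ (p/2) S_n G_n, and A_n G_n as a bound for both A_(np) and C_(np).

Start from S_(pq) ≤ pq/2 for two primes, and use d and ε_3 themselves at three primes. The
normalised constant of S is then d/2 at four primes and is squared at each further prime, while that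
of G is always twice it. Hence, up to a factor whose logarithm is o(2^k), ε_k^inv is at most
(d/2)^(2^k/16) (`epsInv_add_five_le`).

It remains to check (d/2)^(1/16) ≤ C (`rpow_sixteenth_le_constC`). After dividing out d this is
numerical, from d ≤ 1/2, ε_3 ≥ 1/3 and ρ ≥ (5/6)^2. So the stated constant is not obtained by a
recursion involving ρ; it merely dominates (d/2)^(1/16). -/

/-! ### The ℓ¹ norm of the coefficients of a polynomial. -/

section LengthNorm

open Polynomial

/-- The sum of the absolute values of the coefficients of a real polynomial. -/
noncomputable def Polynomial.coeffLength (f : ℝ[X]) : ℝ := ∑ i ∈ f.support, |f.coeff i|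

namespace Polynomial

lemma coeffLength_eq_sum_of_subset {f : ℝ[X]} {s : Finset ℕ} (h : f.support ⊆ s) :
    f.coeffLength = ∑ i ∈ s, |f.coeff i| :=
  Finset.sum_subset h fun i _ hi => by rw [notMem_support_iff.mp hi, abs_zero]

lemma coeffLength_eq_sum_range {f : ℝ[X]} {N : ℕ} (h : f.natDegree < N) :
    f.coeffLength = ∑ i ∈ Finset.range N, |f.coeff i| :=
  coeffLength_eq_sum_of_subset fun i hi =>
    Finset.mem_range.mpr ((le_natDegree_of_mem_supp i hi).trans_lt h)

lemma sum_abs_coeff_le_coeffLength (f : ℝ[X]) (s : Finset ℕ) :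
    ∑ i ∈ s, |f.coeff i| ≤ f.coeffLength := by
  rw [coeffLength_eq_sum_of_subset (s := s ∪ f.support) Finset.subset_union_right]
  exact Finset.sum_le_sum_of_subset_of_nonneg Finset.subset_union_left fun _ _ _ => abs_nonneg _

lemma abs_coeff_le_coeffLength (f : ℝ[X]) (m : ℕ) : |f.coeff m| ≤ f.coeffLength := by
  simpa using f.sum_abs_coeff_le_coeffLength {m}

lemma coeffLength_nonneg (f : ℝ[X]) : 0 ≤ f.coeffLength :=
  Finset.sum_nonneg fun _ _ => abs_nonneg _

lemma coeffLength_zero : (0 : ℝ[X]).coeffLength = 0 := by simp [coeffLength]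

lemma coeffLength_one : (1 : ℝ[X]).coeffLength = 1 := by
  rw [coeffLength_eq_sum_range (N := 1) (by simp)]; simp

lemma coeffLength_neg (f : ℝ[X]) : (-f).coeffLength = f.coeffLength := by
  simp [coeffLength]

lemma coeffLength_add_le (f g : ℝ[X]) :
    (f + g).coeffLength ≤ f.coeffLength + g.coeffLength := by
  rw [coeffLength_eq_sum_of_subset support_add,
    coeffLength_eq_sum_of_subset (Finset.subset_union_left (s₁ := f.support) (s₂ := g.support)),
    coeffLength_eq_sum_of_subset (Finset.subset_union_right (s₁ := f.support) (s₂ := g.support)),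
    ← Finset.sum_add_distrib]
  exact Finset.sum_le_sum fun i _ => by rw [coeff_add]; exact abs_add_le _ _

lemma coeffLength_sub_le (f g : ℝ[X]) :
    (f - g).coeffLength ≤ f.coeffLength + g.coeffLength := by
  rw [sub_eq_add_neg, ← coeffLength_neg g]
  exact coeffLength_add_le _ _

lemma coeffLength_sum_le {ι : Type*} (s : Finset ι) (f : ι → ℝ[X]) :
    (∑ i ∈ s, f i).coeffLength ≤ ∑ i ∈ s, (f i).coeffLength :=
  Finset.le_sum_of_subadditive coeffLength coeffLength_zero.le coeffLength_add_le s f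

lemma coeffLength_C_mul (c : ℝ) (f : ℝ[X]) : (C c * f).coeffLength = |c| * f.coeffLength := by
  have h : (C c * f).natDegree < f.natDegree + 1 := Nat.lt_succ_of_le (natDegree_C_mul_le c f)
  rw [coeffLength_eq_sum_range h, coeffLength_eq_sum_range (Nat.lt_succ_self f.natDegree),
    Finset.mul_sum]
  simp [abs_mul]

lemma coeffLength_X_pow_mul (n : ℕ) (f : ℝ[X]) :
    (X ^ n * f).coeffLength = f.coeffLength := by
  have h : (X ^ n * f).natDegree < n + (f.natDegree + 1) := by
    have h₁ := natDegree_mul_le (p := (X : ℝ[X]) ^ n) (q := f)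
    rw [natDegree_X_pow] at h₁
    omega
  rw [coeffLength_eq_sum_range h, coeffLength_eq_sum_range (Nat.lt_succ_self f.natDegree),
    Finset.sum_range_add, Finset.sum_eq_zero, zero_add]
  · exact Finset.sum_congr rfl fun i _ => by rw [add_comm n i, coeff_X_pow_mul]
  · intro i hi
    rw [coeff_X_pow_mul', if_neg (by simpa using hi), abs_zero]

lemma coeffLength_X_pow (n : ℕ) : (X ^ n : ℝ[X]).coeffLength = 1 := by
  simpa [coeffLength_one] using coeffLength_X_pow_mul n 1

lemma coeffLength_mul_le (f g : ℝ[X]) :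
    (f * g).coeffLength ≤ f.coeffLength * g.coeffLength := by
  calc (f * g).coeffLength = (∑ i ∈ f.support, C (f.coeff i) * (X ^ i * g)).coeffLength := by
        conv_lhs => rw [f.as_sum_support_C_mul_X_pow]
        simp only [Finset.sum_mul, mul_assoc]
    _ ≤ ∑ i ∈ f.support, (C (f.coeff i) * (X ^ i * g)).coeffLength := coeffLength_sum_le _ _
    _ = f.coeffLength * g.coeffLength := by
        simp only [coeffLength_C_mul, coeffLength_X_pow_mul]
        rw [← Finset.sum_mul, ← coeffLength]

lemma coeffLength_geom_sum_le (n N : ℕ) :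
    (∑ i ∈ Finset.range N, (X ^ n : ℝ[X]) ^ i).coeffLength ≤ N := by
  refine (coeffLength_sum_le _ _).trans ?_
  simp [← pow_mul, coeffLength_X_pow]

lemma coeffLength_expand_le {p : ℕ} (f : ℝ[X]) :
    (expand ℝ p f).coeffLength ≤ f.coeffLength := by
  rw [expand_eq_sum, sum]
  refine (coeffLength_sum_le _ _).trans (Finset.sum_le_sum fun i _ => ?_)
  rw [← pow_mul, coeffLength_C_mul, coeffLength_X_pow, mul_one]

/-- The copies -f and x^N f do not overlap. This is the source of the factor 1/2 in the recurrence
for S. -/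
lemma coeffLength_X_pow_sub_one_mul {f : ℝ[X]} {N : ℕ} (h : f.natDegree < N) :
    ((X ^ N - 1) * f).coeffLength = 2 * f.coeffLength := by
  have hN : ((X ^ N - 1) * f).natDegree < N + N := by
    have h₁ := natDegree_mul_le (p := (X : ℝ[X]) ^ N - 1) (q := f)
    have h₂ : ((X : ℝ[X]) ^ N - 1).natDegree = N := natDegree_X_pow_sub_C (r := (1 : ℝ))
    omega
  rw [coeffLength_eq_sum_range hN, coeffLength_eq_sum_range h, Finset.sum_range_add, two_mul]
  congr 1
  · refine Finset.sum_congr rfl fun i hi => ?_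
    have : ¬ N ≤ i := by simpa using hi
    simp [sub_mul, coeff_X_pow_mul', this]
  · refine Finset.sum_congr rfl fun i hi => ?_
    have : f.coeff (i + N) = 0 := coeff_eq_zero_of_natDegree_lt (by omega)
    rw [add_comm N i, sub_mul, coeff_sub, coeff_X_pow_mul, one_mul, this, sub_zero]

lemma abs_coeff_le_of_X_pow_sub_one_mul {f : ℝ[X]} {N : ℕ} (h : f.natDegree < N) (m : ℕ) :
    |f.coeff m| ≤ |((X ^ N - 1) * f).coeff (m + N)| := by
  by_cases hm : f.coeff m = 0
  · rw [hm, abs_zero]; exact abs_nonneg _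
  · have : f.coeff (m + N) = 0 := coeff_eq_zero_of_natDegree_lt (by omega)
    rw [sub_mul, coeff_sub, coeff_X_pow_mul, one_mul, this, sub_zero]

lemma abs_coeff_mul_le {f : ℝ[X]} {B : ℝ} (hB : ∀ m, |f.coeff m| ≤ B) (g : ℝ[X]) (m : ℕ) :
    |(f * g).coeff m| ≤ B * g.coeffLength := by
  have hB₀ : 0 ≤ B := (abs_nonneg _).trans (hB 0)
  rw [mul_comm f g, coeff_mul,
    Finset.Nat.sum_antidiagonal_eq_sum_range_succ (fun i j => g.coeff i * f.coeff j)]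
  calc _ ≤ ∑ i ∈ Finset.range (m + 1), |g.coeff i * f.coeff (m - i)| :=
        Finset.abs_sum_le_sum_abs _ _
    _ ≤ ∑ i ∈ Finset.range (m + 1), B * |g.coeff i| := Finset.sum_le_sum fun i _ => by
        rw [abs_mul, mul_comm]
        exact mul_le_mul_of_nonneg_right (hB _) (abs_nonneg _)
    _ ≤ B * g.coeffLength := by
        rw [← Finset.mul_sum]
        exact mul_le_mul_of_nonneg_left (g.sum_abs_coeff_le_coeffLength _) hB₀

/-- If `n` and `p` are coprime, the shifts of `f(x ^ p)` by multiples `l n` with `l < p` have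
disjoint supports. -/
lemma abs_coeff_geom_sum_mul_expand_le {n p : ℕ} (hp : 0 < p) (hnp : n.Coprime p) {f : ℝ[X]}
    {B : ℝ} (hB : ∀ m, |f.coeff m| ≤ B) (m : ℕ) :
    |((∑ i ∈ Finset.range p, (X ^ n : ℝ[X]) ^ i) * expand ℝ p f).coeff m| ≤ B := by
  have hB₀ : 0 ≤ B := (abs_nonneg _).trans (hB 0)
  have hterm : ∀ l, |((X ^ n : ℝ[X]) ^ l * expand ℝ p f).coeff m| ≤ B := fun l => by
    rw [← pow_mul, coeff_X_pow_mul', coeff_expand hp]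
    split_ifs
    · exact hB _
    all_goals rwa [abs_zero]
  rw [Finset.sum_mul, finsetSum_coeff]
  by_cases hz : ∀ l ∈ Finset.range p, ((X ^ n : ℝ[X]) ^ l * expand ℝ p f).coeff m = 0
  · rwa [Finset.sum_eq_zero hz, abs_zero]
  push Not at hz
  obtain ⟨l, hl, hl₀⟩ := hz
  -- A contributing shift j is determined modulo p by m, so at most one j < p contributes.
  have key : ∀ j, ((X ^ n : ℝ[X]) ^ j * expand ℝ p f).coeff m ≠ 0 → n * j ≡ m [MOD p] := by
    intro j hj
    rw [← pow_mul, coeff_X_pow_mul', coeff_expand hp] at hj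
    split_ifs at hj with h₁ h₂
    · exact (Nat.modEq_iff_dvd' h₁).mpr h₂
    all_goals exact absurd rfl hj
  rw [Finset.sum_eq_single_of_mem l hl]
  · exact hterm l
  intro j hj hjl
  by_contra hj₀
  have h := Nat.ModEq.cancel_left_of_coprime (by rwa [Nat.gcd_comm])
    ((key j hj₀).trans (key l hl₀).symm)
  exact hjl (h.eq_of_lt_of_lt (Finset.mem_range.mp hj) (Finset.mem_range.mp hl))

end Polynomial

end LengthNorm

/-! ### Recurrences in n ↦ np for lengths and heights. -/

section Cofactor

open Polynomial

/-- The polynomial `(X ^ n - 1) / Φ_n`. -/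
noncomputable def cyclotomicCofactor (n : ℕ) : ℝ[X] := ∏ d ∈ n.properDivisors, cyclotomic d ℝ

lemma cyclotomic_mul_cofactor {n : ℕ} (hn : 0 < n) :
    cyclotomic n ℝ * cyclotomicCofactor n = X ^ n - 1 := by
  rw [← prod_cyclotomic_eq_X_pow_sub_one hn, ← Nat.cons_self_properDivisors hn.ne',
    Finset.prod_cons, cyclotomicCofactor]

lemma cyclotomicCofactor_one : cyclotomicCofactor 1 = 1 := by simp [cyclotomicCofactor]

lemma natDegree_cyclotomicCofactor_lt {n : ℕ} (hn : 0 < n) :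
    (cyclotomicCofactor n).natDegree < n := by
  have h := congrArg natDegree (cyclotomic_mul_cofactor hn)
  have h₂ : ((X : ℝ[X]) ^ n - 1).natDegree = n := natDegree_X_pow_sub_C (r := (1 : ℝ))
  have h₀ : (X : ℝ[X]) ^ n - 1 ≠ 0 := X_pow_sub_C_ne_zero hn 1
  have h₃ : cyclotomicCofactor n ≠ 0 := fun h₃ => h₀ <| by
    rw [← cyclotomic_mul_cofactor hn, h₃, mul_zero]
  rw [natDegree_mul (cyclotomic_ne_zero n ℝ) h₃, h₂, natDegree_cyclotomic] at h
  have := Nat.totient_pos.mpr hn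
  omega

lemma cyclotomicCofactor_mul_prime {n p : ℕ} (hn : 0 < n) (hp : p.Prime) (hpn : ¬ p ∣ n) :
    cyclotomicCofactor (n * p) = cyclotomic n ℝ * expand ℝ p (cyclotomicCofactor n) := by
  apply mul_left_cancel₀ (cyclotomic_ne_zero (n * p) ℝ)
  rw [cyclotomic_mul_cofactor (Nat.mul_pos hn hp.pos), ← mul_assoc,
    ← cyclotomic_expand_eq_cyclotomic_mul hp hpn, ← map_mul, cyclotomic_mul_cofactor hn]
  simp [← pow_mul, mul_comm]

/-- Multiplying by x^(np) - 1 replaces the division in Φ_(np) = Φ_n(x^p)/Φ_n(x) by a product of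
polynomials, to which norm inequalities apply. -/
lemma X_pow_sub_one_mul_cyclotomic_mul_prime {n p : ℕ} (hn : 0 < n) (hp : p.Prime)
    (hpn : ¬ p ∣ n) :
    (X ^ (n * p) - 1) * cyclotomic (n * p) ℝ =
      (∑ i ∈ Finset.range p, (X ^ n : ℝ[X]) ^ i) * expand ℝ p (cyclotomic n ℝ) *
        cyclotomicCofactor n := by
  rw [cyclotomic_expand_eq_cyclotomic_mul hp hpn, pow_mul, ← geom_sum_mul,
    ← cyclotomic_mul_cofactor hn]
  ring

lemma natDegree_cyclotomic_mul_prime_lt {n p : ℕ} (hn : 0 < n) (hp : p.Prime) :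
    (cyclotomic (n * p) ℝ).natDegree < n * p := by
  rw [natDegree_cyclotomic]
  exact Nat.totient_lt _ (hp.one_lt.trans_le (Nat.le_mul_of_pos_left p hn))

lemma lengthS_eq_coeffLength (n : ℕ) : lengthS n = (cyclotomic n ℝ).coeffLength := by
  rw [coeffLength_eq_sum_range (N := n.totient + 1) (by rw [natDegree_cyclotomic]; omega)]
  rfl

lemma bddAbove_abs_cyclotomicCoeff (n : ℕ) :
    BddAbove (Set.range fun m => |cyclotomicCoeff n m|) :=
  ⟨_, Set.forall_mem_range.mpr (abs_coeff_le_coeffLength (cyclotomic n ℝ))⟩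

lemma abs_cyclotomicCoeff_le_heightA (n m : ℕ) : |(cyclotomic n ℝ).coeff m| ≤ heightA n :=
  le_ciSup (bddAbove_abs_cyclotomicCoeff n) m

lemma one_le_heightA (n : ℕ) : 1 ≤ heightA n := by
  have h := abs_cyclotomicCoeff_le_heightA n (cyclotomic n ℝ).natDegree
  rwa [coeff_natDegree, (cyclotomic.monic n ℝ).leadingCoeff, abs_one] at h

lemma one_le_lengthS (n : ℕ) : 1 ≤ lengthS n := by
  have h := abs_coeff_le_coeffLength (cyclotomic n ℝ) (cyclotomic n ℝ).natDegree
  rwa [coeff_natDegree, (cyclotomic.monic n ℝ).leadingCoeff, abs_one,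
    ← lengthS_eq_coeffLength] at h

lemma lengthS_one_le : lengthS 1 ≤ 2 := by
  rw [lengthS_eq_coeffLength, cyclotomic_one]
  refine (coeffLength_sub_le _ _).trans ?_
  have := coeffLength_X_pow 1
  rw [pow_one] at this
  rw [this, coeffLength_one]
  norm_num

/-- The sum of the absolute values of the coefficients of `(X ^ n - 1) / Φ_n`. -/
noncomputable def cofactorLength (n : ℕ) : ℝ := (cyclotomicCofactor n).coeffLength

lemma cofactorLength_nonneg (n : ℕ) : 0 ≤ cofactorLength n := coeffLength_nonneg _

lemma cofactorLength_one : cofactorLength 1 = 1 := by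
  rw [cofactorLength, cyclotomicCofactor_one, coeffLength_one]

lemma cofactorLength_mul_prime_le {n p : ℕ} (hn : 0 < n) (hp : p.Prime) (hpn : ¬ p ∣ n) :
    cofactorLength (n * p) ≤ lengthS n * cofactorLength n := by
  rw [cofactorLength, cyclotomicCofactor_mul_prime hn hp hpn, lengthS_eq_coeffLength]
  exact (coeffLength_mul_le _ _).trans
    (mul_le_mul_of_nonneg_left (coeffLength_expand_le _) (coeffLength_nonneg _))

lemma lengthS_mul_prime_le {n p : ℕ} (hn : 0 < n) (hp : p.Prime) (hpn : ¬ p ∣ n) :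
    lengthS (n * p) ≤ p / 2 * (lengthS n * cofactorLength n) := by
  have h := coeffLength_X_pow_sub_one_mul (natDegree_cyclotomic_mul_prime_lt hn hp)
  rw [X_pow_sub_one_mul_cyclotomic_mul_prime hn hp hpn, ← lengthS_eq_coeffLength] at h
  have h₁ : ((∑ i ∈ Finset.range p, (X ^ n : ℝ[X]) ^ i) * expand ℝ p (cyclotomic n ℝ) *
      cyclotomicCofactor n).coeffLength ≤ p * lengthS n * cofactorLength n := by
    refine (coeffLength_mul_le _ _).trans
      (mul_le_mul_of_nonneg_right ?_ (cofactorLength_nonneg n))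
    rw [lengthS_eq_coeffLength]
    exact (coeffLength_mul_le _ _).trans (mul_le_mul (coeffLength_geom_sum_le n p)
      (coeffLength_expand_le _) (coeffLength_nonneg _) (Nat.cast_nonneg p))
  linarith

/-- The geometric sum costs no factor p here, because the shifted copies of Φ_n(x^p) have disjoint
supports; a sup norm times ℓ¹ norm estimate finishes. -/
lemma heightA_mul_prime_le {n p : ℕ} (hn : 0 < n) (hp : p.Prime) (hpn : ¬ p ∣ n) :
    heightA (n * p) ≤ heightA n * cofactorLength n := by
  refine ciSup_le fun m => ?_
  refine (abs_coeff_le_of_X_pow_sub_one_mul (natDegree_cyclotomic_mul_prime_lt hn hp) m).trans ?_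
  rw [X_pow_sub_one_mul_cyclotomic_mul_prime hn hp hpn]
  exact abs_coeff_mul_le (abs_coeff_geom_sum_mul_expand_le hp.pos
    (((Nat.Prime.coprime_iff_not_dvd hp).mpr hpn).symm) (abs_cyclotomicCoeff_le_heightA n)) _ _

lemma coeff_cofactor_mul_prime_le {n p : ℕ} (hn : 0 < n) (hp : p.Prime) (hpn : ¬ p ∣ n) (m : ℕ) :
    |(cyclotomicCofactor (n * p)).coeff m| ≤ heightA n * cofactorLength n := by
  rw [cyclotomicCofactor_mul_prime hn hp hpn]
  exact (abs_coeff_mul_le (abs_cyclotomicCoeff_le_heightA n) _ m).trans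
    (mul_le_mul_of_nonneg_left (coeffLength_expand_le _) (zero_le_one.trans (one_le_heightA n)))

lemma cyclotomic_coeff_zero_ne_zero {n : ℕ} (hn : 0 < n) : (cyclotomic n ℝ).coeff 0 ≠ 0 := by
  intro h
  have h₁ := congrArg (fun f => coeff f 0) (cyclotomic_mul_cofactor hn)
  simp [mul_coeff_zero, h, coeff_X_pow, hn.ne] at h₁

/-- The coefficients of `1 / Φ_n` repeat, up to sign, those of `(X ^ n - 1) / Φ_n`
with period `n`. -/
lemma inverseCyclotomicCoeff_eq {n : ℕ} (hn : 0 < n) (m : ℕ) :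
    inverseCyclotomicCoeff n m = -(cyclotomicCofactor n).coeff (m % n) := by
  set H : PowerSeries ℝ := PowerSeries.mk fun m => -(cyclotomicCofactor n).coeff (m % n) with hH
  -- Periodicity cancels every coefficient of index at least n; the first period is the whole
  -- cofactor, whose degree is below n.
  have hHG : H * (PowerSeries.X ^ n - 1) = ((cyclotomicCofactor n : ℝ[X]) : PowerSeries ℝ) := by
    ext m
    rw [mul_sub, mul_one, map_sub, PowerSeries.coeff_mul_X_pow', hH,
      Polynomial.coeff_coe]
    split_ifs with h
    · rw [PowerSeries.coeff_mk, PowerSeries.coeff_mk, ← Nat.mod_eq_sub_mod h, sub_self,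
        coeff_eq_zero_of_natDegree_lt ((natDegree_cyclotomicCofactor_lt hn).trans_le h)]
    · rw [PowerSeries.coeff_mk, Nat.mod_eq_of_lt (not_le.mp h)]; ring
  have hX : (PowerSeries.X ^ n - 1 : PowerSeries ℝ) ≠ 0 := fun h => by
    have := congrArg (PowerSeries.coeff 0) h
    simp [hn.ne'] at this
  have hΦ : ((cyclotomic n ℝ : ℝ[X]) : PowerSeries ℝ) *
      ((cyclotomicCofactor n : ℝ[X]) : PowerSeries ℝ) = PowerSeries.X ^ n - 1 := by
    rw [← Polynomial.coe_mul, cyclotomic_mul_cofactor hn]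
    simp
  have h₁ : H * ((cyclotomic n ℝ : ℝ[X]) : PowerSeries ℝ) = 1 := by
    apply mul_right_cancel₀ hX
    rw [one_mul, mul_right_comm, hHG, mul_comm, hΦ]
  have h₂ : Psi n = H := ((PowerSeries.eq_inv_iff_mul_eq_one (by
    rw [Polynomial.constantCoeff_coe]
    exact cyclotomic_coeff_zero_ne_zero hn)).mpr h₁).symm
  rw [inverseCyclotomicCoeff, h₂, hH, PowerSeries.coeff_mk]

lemma heightC_le {n : ℕ} (hn : 0 < n) {B : ℝ}
    (hB : ∀ m, |(cyclotomicCofactor n).coeff m| ≤ B) : heightC n ≤ B :=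
  ciSup_le fun m => by rw [inverseCyclotomicCoeff_eq hn, abs_neg]; exact hB _

lemma heightC_le_cofactorLength {n : ℕ} (hn : 0 < n) : heightC n ≤ cofactorLength n :=
  heightC_le hn (abs_coeff_le_coeffLength _)

lemma heightC_mul_prime_le {n p : ℕ} (hn : 0 < n) (hp : p.Prime) (hpn : ¬ p ∣ n) :
    heightC (n * p) ≤ heightA n * cofactorLength n :=
  heightC_le (Nat.mul_pos hn hp.pos) (coeff_cofactor_mul_prime_le hn hp hpn)

lemma heightC_pos {n : ℕ} (hn : 0 < n) : 0 < heightC n := by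
  have hbdd : BddAbove (Set.range fun m => |inverseCyclotomicCoeff n m|) :=
    ⟨cofactorLength n, Set.forall_mem_range.mpr fun m => by
      rw [inverseCyclotomicCoeff_eq hn, abs_neg]; exact abs_coeff_le_coeffLength _ _⟩
  refine lt_of_lt_of_le (abs_pos.mpr ?_) (le_ciSup hbdd 0)
  rw [inverseCyclotomicCoeff_eq hn, Nat.zero_mod, neg_ne_zero]
  intro h
  have h₁ := congrArg (fun f => coeff f 0) (cyclotomic_mul_cofactor hn)
  simp [mul_coeff_zero, h, coeff_X_pow, hn.ne] at h₁

end Cofactor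

/-! ### The length of Φ_(pq). -/

section Binary

open Polynomial

lemma exists_mul_add_mul_eq_mul_add_one {p q : ℕ} (hp : 1 < p) (hq : 1 < q) (h : p.Coprime q) :
    ∃ u v : ℕ, u * p + v * q = p * q + 1 ∧ u ≤ q ∧ v ≤ p := by
  obtain ⟨u, hu, hup⟩ := Nat.exists_mul_mod_eq_one_of_coprime h hq
  have hpos : 1 ≤ u * p := by
    rcases Nat.eq_zero_or_pos u with rfl | hu₀
    · simp at hup
    · exact Nat.mul_pos hu₀ (by omega)
  have hle : u * p + p ≤ p * q := by nlinarith
  have hdvd : q ∣ p * q + 1 - u * p := by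
    have h₁ : q ∣ u * p - 1 := by
      rw [mul_comm]; exact (Nat.modEq_iff_dvd' (by rwa [mul_comm])).mp
        (by rw [Nat.ModEq, hup, Nat.mod_eq_of_lt hq])
    have h₂ : p * q + 1 - u * p = p * q - (u * p - 1) := by omega
    rw [h₂]
    exact Nat.dvd_sub (dvd_mul_left q p) h₁
  obtain ⟨v, hv⟩ := hdvd
  refine ⟨u, v, by rw [mul_comm v q]; omega, hu.le, ?_⟩
  have : q * v ≤ q * p := by rw [mul_comm q p]; omega
  exact Nat.le_of_mul_le_mul_left this (by omega)

lemma cyclotomic_mul_primes {p q : ℕ} (hp : p.Prime) (hq : q.Prime) (hpq : p ≠ q) :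
    cyclotomic (p * q) ℝ * ((X ^ p - 1) * (X ^ q - 1)) = (X ^ (p * q) - 1) * (X - 1) := by
  have := Fact.mk hp
  have h₁ := cyclotomic_expand_eq_cyclotomic_mul hq
    (fun h => hpq ((Nat.prime_dvd_prime_iff_eq hq hp).mp h).symm) ℝ
  have h₂ : cyclotomic p ℝ * (X - 1) = X ^ p - 1 := cyclotomic_prime_mul_X_sub_one ℝ p
  have h₃ : expand ℝ q (cyclotomic p ℝ) * (X ^ q - 1) = X ^ (p * q) - 1 := by
    have := congrArg (expand ℝ q) h₂
    simpa [← pow_mul, mul_comm p q] using this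
  rw [← h₂, ← h₃, h₁]
  ring

/-- With up + vq = pq + 1, u' = q - u and v' = p - v, one has Φ_(pq) = UV - x U'V', where U, U' are
geometric sums in x^p of u, u' terms and V, V' are those in x^q of v, v' terms. So the length is at
most uv + u'v' = 2uv - 1. -/
lemma lengthS_mul_primes_le {p q : ℕ} (hp : p.Prime) (hq : q.Prime) (hpq : p ≠ q) :
    lengthS (p * q) ≤ p * q / 2 := by
  obtain ⟨u, v, huv, hu, hv⟩ := exists_mul_add_mul_eq_mul_add_one hp.one_lt hq.one_lt
    ((Nat.coprime_primes hp hq).mpr hpq)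
  obtain ⟨u', rfl⟩ := Nat.exists_eq_add_of_le hu
  obtain ⟨v', rfl⟩ := Nat.exists_eq_add_of_le hv
  set p := v + v' with hpdef
  set q := u + u' with hqdef
  have hX : ∀ {n : ℕ}, 0 < n → (X : ℝ[X]) ^ n - 1 ≠ 0 := fun hn => X_pow_sub_C_ne_zero hn 1
  -- The common factor x^(pq) lets the exponent relations be used without negative powers.
  have key : X ^ (p * q) * cyclotomic (p * q) ℝ =
      X ^ (p * q) * ((∑ i ∈ Finset.range u, (X ^ p : ℝ[X]) ^ i) *
        ∑ i ∈ Finset.range v, (X ^ q : ℝ[X]) ^ i) -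
      X ^ (p * q + 1) * ((∑ i ∈ Finset.range u', (X ^ p : ℝ[X]) ^ i) *
        ∑ i ∈ Finset.range v', (X ^ q : ℝ[X]) ^ i) := by
    apply mul_right_cancel₀ (mul_ne_zero (hX hp.pos) (hX hq.pos))
    have e₁ := geom_sum_mul (X ^ p : ℝ[X]) u
    have e₂ := geom_sum_mul (X ^ q : ℝ[X]) v
    have e₃ := geom_sum_mul (X ^ p : ℝ[X]) u'
    have e₄ := geom_sum_mul (X ^ q : ℝ[X]) v'
    rw [mul_assoc, cyclotomic_mul_primes hp hq hpq]
    have a₁ : (X : ℝ[X]) ^ (p * q) = (X ^ p) ^ u * (X ^ p) ^ u' := by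
      rw [← pow_add, ← pow_mul]
    have a₂ : (X : ℝ[X]) ^ (p * q) = (X ^ q) ^ v * (X ^ q) ^ v' := by
      rw [← pow_add, ← pow_mul, mul_comm q]
    have a₃ : (X ^ p : ℝ[X]) ^ u * (X ^ q) ^ v = X ^ (p * q) * X := by
      rw [← pow_mul, ← pow_mul, ← pow_add, ← pow_succ, ← huv, mul_comm p, mul_comm q]
    rw [pow_succ (X : ℝ[X]) (p * q)]
    generalize (∑ i ∈ Finset.range u, (X ^ p : ℝ[X]) ^ i) = U at *
    generalize (∑ i ∈ Finset.range v, (X ^ q : ℝ[X]) ^ i) = V at *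
    generalize (∑ i ∈ Finset.range u', (X ^ p : ℝ[X]) ^ i) = U' at *
    generalize (∑ i ∈ Finset.range v', (X ^ q : ℝ[X]) ^ i) = V' at *
    have lhs : (X ^ (p * q) * (U * V) - X ^ (p * q) * X * (U' * V')) *
        ((X ^ p - 1) * (X ^ q - 1)) =
        X ^ (p * q) * ((U * (X ^ p - 1)) * (V * (X ^ q - 1))) -
        (X ^ (p * q) * X) * ((U' * (X ^ p - 1)) * (V' * (X ^ q - 1))) := by ring
    rw [lhs, e₁, e₂, e₃, e₄]
    generalize (X : ℝ[X]) ^ (p * q) = Z at *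
    generalize (X ^ p : ℝ[X]) ^ u = a at *
    generalize (X ^ p : ℝ[X]) ^ u' = a' at *
    generalize (X ^ q : ℝ[X]) ^ v = b at *
    generalize (X ^ q : ℝ[X]) ^ v' = b' at *
    have f₁ : Z * X * a' = b * Z := by linear_combination (-a') * a₃ - b * a₁
    have f₂ : Z * X * b' = a * Z := by linear_combination (-b') * a₃ - a * a₂
    have f₃ : Z * X * a' * b' = Z * Z := by linear_combination b' * f₁ - Z * a₂
    linear_combination (-Z) * a₃ + f₃ - f₁ - f₂
  have hS : lengthS (p * q) ≤ u * v + u' * v' := by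
    rw [lengthS_eq_coeffLength, ← coeffLength_X_pow_mul (p * q), key]
    refine (coeffLength_sub_le _ _).trans ?_
    rw [coeffLength_X_pow_mul, coeffLength_X_pow_mul]
    exact add_le_add
      ((coeffLength_mul_le _ _).trans (mul_le_mul (coeffLength_geom_sum_le _ _)
        (coeffLength_geom_sum_le _ _) (coeffLength_nonneg _) (Nat.cast_nonneg _)))
      ((coeffLength_mul_le _ _).trans (mul_le_mul (coeffLength_geom_sum_le _ _)
        (coeffLength_geom_sum_le _ _) (coeffLength_nonneg _) (Nat.cast_nonneg _)))
  have h₁ : u * v = u' * v' + 1 := by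
    have : u * p + v * q = p * q + 1 := huv
    rw [hpdef, hqdef] at this
    nlinarith
  -- AM-GM for up and vq, whose sum is pq + 1, followed by rounding down to an integer.
  have h₂ : 4 * (u * v) ≤ p * q + 2 := by
    have hpq₁ : 2 ≤ p * q := by nlinarith [hp.two_le, hq.two_le]
    have h₃ : 4 * ((u * p) * (v * q)) ≤ (p * q + 1) ^ 2 := by
      rw [← huv]; nlinarith [sq_nonneg ((u * p : ℤ) - v * q)]
    have h₄ : 4 * (u * v) * (p * q) < (p * q + 3) * (p * q) := by nlinarith
    have := Nat.lt_of_mul_lt_mul_right h₄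
    omega
  have h₁' : (u : ℝ) * v = u' * v' + 1 := by exact_mod_cast h₁
  have h₂' : 4 * ((u : ℝ) * v) ≤ p * q + 2 := by exact_mod_cast h₂
  linarith

end Binary

/-! ### Iterating the recurrences along p_1, …, p_k. -/

section PrimeProducts

lemma DistinctOddPrimes.of_succ {k : ℕ} {p : ℕ → ℕ} (h : DistinctOddPrimes (k + 1) p) :
    DistinctOddPrimes k p := by
  have hsub : Set.Icc 1 k ⊆ Set.Icc 1 (k + 1) := Set.Icc_subset_Icc_right (Nat.le_succ k)
  exact ⟨fun i hi => h.1 i (hsub hi), h.2.mono hsub⟩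

lemma DistinctOddPrimes.prime {k : ℕ} {p : ℕ → ℕ} (h : DistinctOddPrimes k p) {i : ℕ}
    (h₁ : 1 ≤ i) (h₂ : i ≤ k) : (p i).Prime :=
  (h.1 i ⟨h₁, h₂⟩).1

lemma primeProd_zero (p : ℕ → ℕ) : primeProd 0 p = 1 := by simp [primeProd]

lemma primeProd_succ (k : ℕ) (p : ℕ → ℕ) :
    primeProd (k + 1) p = primeProd k p * p (k + 1) := by
  rw [primeProd, Finset.prod_Icc_succ_top (by omega), primeProd]

lemma DistinctOddPrimes.primeProd_pos {k : ℕ} {p : ℕ → ℕ} (h : DistinctOddPrimes k p) :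
    0 < primeProd k p :=
  Finset.prod_pos fun _ hi => (h.1 _ (Finset.mem_Icc.mp hi)).1.pos

lemma DistinctOddPrimes.boundM_pos {k : ℕ} {p : ℕ → ℕ} (h : DistinctOddPrimes k p) :
    (0 : ℝ) < boundM k p := by
  refine Nat.cast_pos.mpr (Finset.prod_pos fun i hi => pow_pos ?_ _)
  rw [Finset.mem_Icc] at hi
  exact (h.prime hi.1 (by omega)).pos

lemma DistinctOddPrimes.not_dvd_primeProd {k : ℕ} {p : ℕ → ℕ}
    (h : DistinctOddPrimes (k + 1) p) : ¬ p (k + 1) ∣ primeProd k p := by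
  have hp := h.prime (Nat.le_add_left 1 k) le_rfl
  rw [primeProd, hp.prime.dvd_finsetProd_iff]
  rintro ⟨i, hi, hdvd⟩
  rw [Finset.mem_Icc] at hi
  have heq := (Nat.prime_dvd_prime_iff_eq hp (h.prime hi.1 (by omega))).mp hdvd
  have := h.2 ⟨by omega, le_rfl⟩ ⟨hi.1, by omega⟩ heq
  omega

lemma exists_distinctOddPrimes (k : ℕ) : ∃ p : ℕ → ℕ, DistinctOddPrimes k p := by
  -- The enumeration is 0-based with value 2 at 0, so the indices from 1 on give odd primes.
  refine ⟨Nat.nth Nat.Prime, fun i hi => ?_,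
    (Nat.nth_injective Nat.infinite_setOfPred_prime).injOn⟩
  have hp : (Nat.nth Nat.Prime i).Prime := Nat.prime_nth_prime i
  refine ⟨hp, hp.odd_of_ne_two fun h => ?_⟩
  rw [← Nat.nth_prime_zero_eq_two] at h
  have := Nat.nth_injective Nat.infinite_setOfPred_prime h
  exact absurd hi.1 (by omega)

/-- The product `∏_{i = 1}^{k - 1} p_i ^ (2 ^ (k - 1 - i))`. -/
noncomputable def lengthWeight (k : ℕ) (p : ℕ → ℕ) : ℝ :=
  ∏ i ∈ Finset.Icc 1 (k - 1), (p i : ℝ) ^ 2 ^ (k - 1 - i)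

lemma lengthWeight_one (p : ℕ → ℕ) : lengthWeight 1 p = 1 := by simp [lengthWeight]

lemma lengthWeight_add_two (j : ℕ) (p : ℕ → ℕ) :
    lengthWeight (j + 2) p = p (j + 1) * lengthWeight (j + 1) p ^ 2 := by
  simp only [lengthWeight, Nat.add_sub_cancel, show j + 2 - 1 = j + 1 by omega]
  rw [Finset.prod_Icc_succ_top (by omega), ← Finset.prod_pow, Nat.sub_self, pow_zero, pow_one,
    mul_comm]
  congr 1
  refine Finset.prod_congr rfl fun i hi => ?_
  rw [Finset.mem_Icc] at hi
  rw [← pow_mul, ← pow_succ, Nat.succ_sub hi.2]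

/-- Exponents add up as (2^m - 1) + 2^m = 2^(m+1) - 1. -/
lemma boundM_add_two (j : ℕ) (p : ℕ → ℕ) :
    (boundM (j + 2) p : ℝ) = boundM (j + 1) p * lengthWeight (j + 1) p := by
  have h : boundM (j + 1) p = ∏ i ∈ Finset.Icc 1 j, p i ^ (2 ^ (j - i) - 1) := by
    rw [boundM]
    -- The added index j carries exponent 2^0 - 1 = 0.
    refine Finset.prod_subset_one_on_sdiff (Finset.Icc_subset_Icc_right (by omega)) ?_ ?_
    · intro i hi
      simp only [Finset.mem_sdiff, Finset.mem_Icc] at hi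
      obtain rfl : i = j := by omega
      simp
    · intro i _
      rw [show j + 1 - i - 1 = j - i by omega]
  rw [h, boundM, lengthWeight, Nat.add_sub_cancel, Nat.add_sub_cancel, Nat.cast_prod,
    Nat.cast_prod, ← Finset.prod_mul_distrib]
  refine Finset.prod_congr rfl fun i hi => ?_
  rw [Finset.mem_Icc] at hi
  push_cast
  rw [← pow_add]
  congr 1
  rw [show j + 2 - i - 1 = (j - i) + 1 by omega, pow_succ]
  have := Nat.one_le_two_pow (n := j - i)
  omega

/-- Bounds for `S`, `G` and `A` at `p_1 ⋯ p_k`, where `G` is the length of `(X ^ n - 1) / Φ_n`. -/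
structure HasWeightBounds (k : ℕ) (p : ℕ → ℕ) (s g a : ℝ) : Prop where
  lengthS_le : lengthS (primeProd k p) ≤ s * (p k * lengthWeight k p)
  cofactorLength_le : cofactorLength (primeProd k p) ≤ g * lengthWeight k p
  heightA_le : heightA (primeProd k p) ≤ a * boundM k p

namespace HasWeightBounds

variable {j : ℕ} {p : ℕ → ℕ} {s g a : ℝ}

lemma lengthS_mul_cofactorLength_le (h : HasWeightBounds (j + 1) p s g a) :
    lengthS (primeProd (j + 1) p) * cofactorLength (primeProd (j + 1) p) ≤
      s * g * lengthWeight (j + 2) p := by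
  have h₁ := mul_le_mul h.lengthS_le h.cofactorLength_le (cofactorLength_nonneg _)
    ((zero_le_one.trans (one_le_lengthS _)).trans h.lengthS_le)
  rw [lengthWeight_add_two]
  linarith

lemma heightA_mul_cofactorLength_le (h : HasWeightBounds (j + 1) p s g a) :
    heightA (primeProd (j + 1) p) * cofactorLength (primeProd (j + 1) p) ≤
      a * g * boundM (j + 2) p := by
  have h₁ := mul_le_mul h.heightA_le h.cofactorLength_le (cofactorLength_nonneg _)
    ((zero_le_one.trans (one_le_heightA _)).trans h.heightA_le)
  rw [boundM_add_two]
  linarith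

/-- The weights W_k and M_k satisfy W_(k+1) = p_k W_k^2 and M_(k+1) = M_k W_k, so they absorb all
primes and leave a recursion on the numerical constants alone. -/
lemma succ (h : HasWeightBounds (j + 1) p s g a) (hp : DistinctOddPrimes (j + 2) p) :
    HasWeightBounds (j + 2) p (s * g / 2) (s * g) (a * g) := by
  have hn := hp.of_succ.primeProd_pos
  have hq := hp.prime (i := j + 2) (by omega) le_rfl
  have hd := hp.not_dvd_primeProd
  refine ⟨?_, ?_, ?_⟩ <;> rw [primeProd_succ]
  · refine (lengthS_mul_prime_le hn hq hd).trans ?_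
    have := mul_le_mul_of_nonneg_left h.lengthS_mul_cofactorLength_le
      (by positivity : (0 : ℝ) ≤ p (j + 1 + 1) / 2)
    exact this.trans (le_of_eq (by ring))
  · exact (cofactorLength_mul_prime_le hn hq hd).trans h.lengthS_mul_cofactorLength_le
  · exact (heightA_mul_prime_le hn hq hd).trans h.heightA_mul_cofactorLength_le

lemma heightC_le (h : HasWeightBounds (j + 1) p s g a) (hp : DistinctOddPrimes (j + 2) p) :
    heightC (primeProd (j + 2) p) ≤ a * g * boundM (j + 2) p := by
  rw [primeProd_succ]
  exact (heightC_mul_prime_le hp.of_succ.primeProd_pos (hp.prime (by omega) le_rfl)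
    hp.not_dvd_primeProd).trans h.heightA_mul_cofactorLength_le

end HasWeightBounds

lemma hasWeightBounds_one {p : ℕ → ℕ} (hp : DistinctOddPrimes 1 p) :
    HasWeightBounds 1 p 1 2 (heightA 1) := by
  have hq := hp.prime le_rfl le_rfl
  have hd : ¬ p 1 ∣ 1 := hq.not_dvd_one
  refine ⟨?_, ?_, ?_⟩ <;> rw [primeProd_succ, primeProd_zero]
  · have h := lengthS_mul_prime_le one_pos hq hd
    rw [cofactorLength_one] at h
    rw [lengthWeight_one]
    have := mul_le_mul_of_nonneg_left lengthS_one_le (by positivity : (0 : ℝ) ≤ p 1 / 2)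
    linarith
  · have h := cofactorLength_mul_prime_le one_pos hq hd
    rw [cofactorLength_one] at h
    rw [lengthWeight_one]
    linarith [lengthS_one_le]
  · have h := heightA_mul_prime_le one_pos hq hd
    rw [cofactorLength_one] at h
    simpa [boundM] using h

lemma hasWeightBounds_two {p : ℕ → ℕ} (hp : DistinctOddPrimes 2 p) :
    HasWeightBounds 2 p (1 / 2) 2 (heightA 1 * 2) := by
  have h := (hasWeightBounds_one hp.of_succ).succ hp
  refine ⟨?_, by simpa using h.cofactorLength_le, h.heightA_le⟩
  -- The general step would give only s = 1; the binary formula halves it.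
  have h₁ := lengthS_mul_primes_le (hp.prime le_rfl one_le_two) (hp.prime one_le_two le_rfl)
    fun h => absurd (hp.2 ⟨le_rfl, one_le_two⟩ ⟨one_le_two, le_rfl⟩ h) (by norm_num)
  rw [lengthWeight_add_two, lengthWeight_one, primeProd_succ, primeProd_succ, primeProd_zero,
    one_mul]
  exact h₁.trans (le_of_eq (by norm_num; ring))

lemma hasWeightBounds_three {p : ℕ → ℕ} (hp : DistinctOddPrimes 3 p) :
    HasWeightBounds 3 p (1 / 2) 1 (heightA 1 * 2 * 2) := by
  have h := (hasWeightBounds_two hp.of_succ).succ hp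
  norm_num at h ⊢
  exact h

lemma lengthWeight_three (p : ℕ → ℕ) : lengthWeight 3 p = (p 1 : ℝ) ^ 2 * p 2 := by
  rw [lengthWeight_add_two, lengthWeight_add_two, lengthWeight_one]
  norm_num
  ring

lemma exists_hasWeightBounds (j : ℕ) :
    ∃ s g a : ℝ, ∀ p : ℕ → ℕ, DistinctOddPrimes (j + 1) p → HasWeightBounds (j + 1) p s g a := by
  induction j with
  | zero => exact ⟨_, _, _, fun p hp => hasWeightBounds_one hp⟩
  | succ j ih =>
    obtain ⟨s, g, a, h⟩ := ih
    exact ⟨_, _, _, fun p hp => (h p hp.of_succ).succ hp⟩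

end PrimeProducts

/-! ### Well-definedness of the constants and the final comparison. -/

section Constants

/-- Admissibility means c ≥ H/M for every tuple of primes, a closed condition, so the infimum is
attained; a single tuple with H > 0 keeps it positive. -/
lemma isLeast_sInf_admissibleConstants {H : ℕ → ℝ} {k : ℕ} {c : ℝ}
    (hpos : ∀ n, 0 < n → 0 < H n)
    (hc : ∀ p, DistinctOddPrimes k p → H (primeProd k p) ≤ c * boundM k p) :
    IsLeast (admissibleConstants H k) (sInf (admissibleConstants H k)) := by
  have hlow : ∀ p, DistinctOddPrimes k p → ∀ x ∈ admissibleConstants H k,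
      H (primeProd k p) / boundM k p ≤ x := fun p hp x hx =>
    (div_le_iff₀ hp.boundM_pos).mpr (hx.2 p hp)
  obtain ⟨p₀, hp₀⟩ := exists_distinctOddPrimes k
  have hquot : 0 < H (primeProd k p₀) / boundM k p₀ :=
    div_pos (hpos _ hp₀.primeProd_pos) hp₀.boundM_pos
  have hne : (admissibleConstants H k).Nonempty :=
    ⟨c, hquot.trans_le ((div_le_iff₀ hp₀.boundM_pos).mpr (hc p₀ hp₀)), hc⟩
  refine ⟨⟨hquot.trans_le (le_csInf hne (hlow p₀ hp₀)), fun p hp => ?_⟩,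
    fun x hx => csInf_le ⟨0, fun y hy => hy.1.le⟩ hx⟩
  exact (div_le_iff₀ hp.boundM_pos).mp (le_csInf hne (hlow p hp))

lemma isLeast_eps_three : IsLeast (admissibleConstants heightA 3) (eps 3) :=
  isLeast_sInf_admissibleConstants (fun n _ => zero_lt_one.trans_le (one_le_heightA n))
    fun _ hp => (hasWeightBounds_three hp).heightA_le

lemma exists_heightC_le (k : ℕ) :
    ∃ c : ℝ, ∀ p, DistinctOddPrimes k p → heightC (primeProd k p) ≤ c * boundM k p := by
  match k with
  -- The recurrence for C presupposes bounds at one or more primes, so k = 0 and k = 1 are bounded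
  -- by G directly.
  | 0 =>
    refine ⟨1, fun p _ => ?_⟩
    rw [primeProd_zero]
    simpa [boundM, cofactorLength_one] using heightC_le_cofactorLength one_pos
  | 1 =>
    refine ⟨2, fun p hp => (heightC_le_cofactorLength hp.primeProd_pos).trans ?_⟩
    simpa [boundM, lengthWeight_one] using (hasWeightBounds_one hp).cofactorLength_le
  | j + 2 =>
    obtain ⟨s, g, a, h⟩ := exists_hasWeightBounds j
    exact ⟨a * g, fun p hp => (h p hp.of_succ).heightC_le hp⟩

lemma isLeast_epsInv (k : ℕ) : IsLeast (admissibleConstants heightC k) (epsInv k) :=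
  isLeast_sInf_admissibleConstants (fun _ hn => heightC_pos hn) (exists_heightC_le k).choose_spec

lemma epsInv_pos (k : ℕ) : 0 < epsInv k := (isLeast_epsInv k).1.1

lemma epsInv_le {k : ℕ} {c : ℝ}
    (hc : ∀ p, DistinctOddPrimes k p → heightC (primeProd k p) ≤ c * boundM k p) :
    epsInv k ≤ c := by
  obtain ⟨p, hp⟩ := exists_distinctOddPrimes k
  refine (isLeast_epsInv k).2 ⟨pos_of_mul_pos_left ?_ hp.boundM_pos.le, hc⟩
  exact (heightC_pos hp.primeProd_pos).trans_le (hc p hp)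

/-- The sequence `p, q, r` indexed from `1`. -/
def tripleSeq (p q r : ℕ) : ℕ → ℕ := fun i => if i = 1 then p else if i = 2 then q else r

lemma distinctOddPrimes_tripleSeq {p q r : ℕ} (hp : p.Prime) (hq : q.Prime) (hr : r.Prime)
    (hp' : Odd p) (hq' : Odd q) (hr' : Odd r) (hpq : p ≠ q) (hpr : p ≠ r) (hqr : q ≠ r) :
    DistinctOddPrimes 3 (tripleSeq p q r) := by
  refine ⟨fun i hi => ?_, fun i hi j hj hij => ?_⟩
  · obtain ⟨h₁, h₂⟩ := hi
    interval_cases i <;> simp [tripleSeq, *]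
  · obtain ⟨h₁, h₂⟩ := hi
    obtain ⟨h₃, h₄⟩ := hj
    interval_cases i <;> interval_cases j <;> simp_all [tripleSeq, eq_comm]

lemma primeProd_three (p : ℕ → ℕ) : primeProd 3 p = p 1 * p 2 * p 3 := by
  rw [primeProd_succ, primeProd_succ, primeProd_succ, primeProd_zero, one_mul]

lemma ternaryRatios_le_half {t : ℝ} (ht : t ∈ ternaryRatios) : t ≤ 1 / 2 := by
  obtain ⟨p, q, r, hp, hq, hr, hp', hq', hr', hpq, hpr, hqr, rfl⟩ := ht
  have h := (hasWeightBounds_three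
    (distinctOddPrimes_tripleSeq hp hq hr hp' hq' hr' hpq hpr hqr)).lengthS_le
  rw [primeProd_three, lengthWeight_three] at h
  have hpos : (0 : ℝ) < (p : ℝ) ^ 2 * q * r := by
    have := hp.pos; have := hq.pos; have := hr.pos
    positivity
  rw [div_le_iff₀ hpos]
  simp only [tripleSeq] at h
  norm_num at h
  linarith

lemma mem_ternaryRatios {p : ℕ → ℕ} (hp : DistinctOddPrimes 3 p) :
    lengthS (primeProd 3 p) / ((p 1 : ℝ) ^ 2 * p 2 * p 3) ∈ ternaryRatios := by
  have hne : ∀ {i j : ℕ}, 1 ≤ i → i < j → j ≤ 3 → p i ≠ p j := fun h₁ h₂ h₃ h =>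
    h₂.ne (hp.2 ⟨h₁, by omega⟩ ⟨by omega, h₃⟩ h)
  obtain ⟨h₁, h₁'⟩ := hp.1 1 (by simp)
  obtain ⟨h₂, h₂'⟩ := hp.1 2 (by simp)
  obtain ⟨h₃, h₃'⟩ := hp.1 3 (by simp)
  exact ⟨p 1, p 2, p 3, h₁, h₂, h₃, h₁', h₂', h₃', hne (by simp) (by simp) (by simp),
    hne (by simp) (by simp) (by simp), hne (by simp) (by simp) (by simp),
    by rw [primeProd_three]⟩

lemma isLUB_constD : IsLUB ternaryRatios constD := by
  obtain ⟨p, hp⟩ := exists_distinctOddPrimes 3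
  exact Real.isLUB_sSup ⟨_, mem_ternaryRatios hp⟩ ⟨1 / 2, fun _ => ternaryRatios_le_half⟩

lemma constD_le_half : constD ≤ 1 / 2 := isLUB_constD.2 fun _ => ternaryRatios_le_half

lemma DistinctOddPrimes.ternary_denominator_pos {p : ℕ → ℕ} (hp : DistinctOddPrimes 3 p) :
    (0 : ℝ) < (p 1 : ℝ) ^ 2 * p 2 * p 3 := by
  have := (hp.prime (i := 1) (by simp) (by simp)).pos
  have := (hp.prime (i := 2) (by simp) (by simp)).pos
  have := (hp.prime (i := 3) (by simp) (by simp)).pos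
  positivity

lemma constD_pos : 0 < constD := by
  obtain ⟨p, hp⟩ := exists_distinctOddPrimes 3
  exact (div_pos (zero_lt_one.trans_le (one_le_lengthS _)) hp.ternary_denominator_pos).trans_le
    (isLUB_constD.1 (mem_ternaryRatios hp))

lemma hasWeightBounds_three_constD {p : ℕ → ℕ} (hp : DistinctOddPrimes 3 p) :
    HasWeightBounds 3 p constD 1 (eps 3) := by
  refine ⟨?_, (hasWeightBounds_three hp).cofactorLength_le, isLeast_eps_three.1.2 p hp⟩
  have := (div_le_iff₀ hp.ternary_denominator_pos).mp (isLUB_constD.1 (mem_ternaryRatios hp))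
  rw [lengthWeight_three]
  linarith

/-- From four primes on g = 2s, so each step (s, g) ↦ (sg/2, sg) squares s; the constant for A
collects the product of the successive values of g. -/
lemma hasWeightBounds_add_four (j : ℕ) {p : ℕ → ℕ} (hp : DistinctOddPrimes (j + 4) p) :
    HasWeightBounds (j + 4) p ((constD / 2) ^ 2 ^ j) (2 * (constD / 2) ^ 2 ^ j)
      (eps 3 * 2 ^ j * (constD / 2) ^ (2 ^ j - 1)) := by
  induction j with
  | zero =>
    have h := (hasWeightBounds_three_constD hp.of_succ).succ hp
    norm_num at h ⊢
    convert h using 1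
    ring
  | succ j ih =>
    have h := (ih hp.of_succ).succ hp
    have e₁ : (constD / 2) ^ 2 ^ (j + 1) = (constD / 2) ^ 2 ^ j * (constD / 2) ^ 2 ^ j := by
      rw [← pow_add, ← two_mul, ← pow_succ']
    have e₂ : (constD / 2) ^ (2 ^ (j + 1) - 1) =
        (constD / 2) ^ (2 ^ j - 1) * (constD / 2) ^ 2 ^ j := by
      rw [← pow_add]
      have := Nat.one_le_two_pow (n := j)
      congr 1
      rw [pow_succ]
      omega
    rw [e₁, e₂]
    convert h using 1 <;> ring

lemma epsInv_add_five_le (j : ℕ) :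
    epsInv (j + 5) ≤ eps 3 * 2 ^ (j + 1) * (constD / 2) ^ (2 ^ (j + 1) - 1) := by
  refine epsInv_le fun p hp => ?_
  have h := (hasWeightBounds_add_four j hp.of_succ).heightC_le hp
  refine h.trans (le_of_eq ?_)
  have e₂ : (constD / 2) ^ (2 ^ (j + 1) - 1) =
      (constD / 2) ^ (2 ^ j - 1) * (constD / 2) ^ 2 ^ j := by
    rw [← pow_add]
    have := Nat.one_le_two_pow (n := j)
    congr 1
    rw [pow_succ]
    omega
  rw [e₂]
  ring

/-- At 3·5·7 the weight M_3 is 3, and the height of a monic polynomial is at least 1. -/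
lemma third_le_eps_three : 1 / 3 ≤ eps 3 := by
  have hp := distinctOddPrimes_tripleSeq Nat.prime_three Nat.prime_five
    (by norm_num : Nat.Prime 7) (by decide) (by decide) (by decide) (by norm_num) (by norm_num)
    (by norm_num)
  have h := (one_le_heightA _).trans (isLeast_eps_three.1.2 _ hp)
  have hM : boundM 3 (tripleSeq 3 5 7) = 3 := by simp [boundM, tripleSeq]
  rw [hM] at h
  push_cast at h
  linarith

/-- Every base lies in [5/6, 1) and the exponents 1/2^i sum to 2. The same geometric comparison
gives convergence of the product. -/
lemma le_constRho : (5 / 6 : ℝ) ^ 2 ≤ constRho := by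
  set f : ℕ → ℝ := fun i => ((2 * (i : ℝ) + 5) / (2 * (i : ℝ) + 6)) ^ ((1 : ℝ) / 2 ^ i) with hf
  have hpos : ∀ i, 0 < f i := fun i => by positivity
  have hlog : ∀ i, Real.log (f i) =
      1 / 2 ^ i * Real.log ((2 * (i : ℝ) + 5) / (2 * (i : ℝ) + 6)) := fun i =>
    Real.log_rpow (by positivity) _
  have hlow : ∀ i, (1 / 2 : ℝ) ^ i * Real.log (5 / 6) ≤ Real.log (f i) := fun i => by
    rw [hlog, one_div_pow]
    refine mul_le_mul_of_nonneg_left (Real.log_le_log (by norm_num) ?_) (by positivity)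
    rw [div_le_div_iff₀ (by norm_num) (by positivity)]
    have : (0 : ℝ) ≤ i := Nat.cast_nonneg i
    linarith
  have hup : ∀ i, Real.log (f i) ≤ 0 := fun i => by
    rw [hlog]
    refine mul_nonpos_of_nonneg_of_nonpos (by positivity) (Real.log_nonpos (by positivity) ?_)
    rw [div_le_one (by positivity)]
    linarith
  have hgeom : HasSum (fun i : ℕ => (1 / 2 : ℝ) ^ i * Real.log (5 / 6)) (2 * Real.log (5 / 6)) :=
    hasSum_geometric_two.mul_right _
  have hsum : Summable fun i => Real.log (f i) := by
    rw [← summable_neg_iff]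
    exact Summable.of_nonneg_of_le (fun i => neg_nonneg.mpr (hup i))
      (fun i => neg_le_neg (hlow i)) hgeom.summable.neg
  have h := hasSum_le hlow hgeom hsum.hasSum
  rw [constRho, ← Real.rexp_tsum_eq_tprod hpos hsum]
  refine le_trans (le_of_eq ?_) (Real.exp_le_exp.mpr h)
  rw [mul_comm, Real.exp_mul, Real.exp_log (by norm_num)]
  norm_num

lemma rpow_sixteenth_le_constC : (constD / 2) ^ ((1 : ℝ) / 16) ≤ constC := by
  have hd := constD_pos
  have hd' := constD_le_half
  have e : (constD / 2) ^ ((1 : ℝ) / 16) = ((constD / 2) ^ 2) ^ ((1 : ℝ) / 32) := by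
    rw [← Real.rpow_natCast, ← Real.rpow_mul (by positivity)]
    norm_num
  rw [e, constC]
  refine Real.rpow_le_rpow (by positivity) ?_ (by norm_num)
  -- Here 3^(-3/2) = 0.1924….
  have h₁ : (19 / 100 : ℝ) ≤ eps 3 ^ ((3 : ℝ) / 2) := by
    have h₂ : ((1 : ℝ) / 3) ^ ((3 : ℝ) / 2) ≤ eps 3 ^ ((3 : ℝ) / 2) :=
      Real.rpow_le_rpow (by norm_num) third_le_eps_three (by norm_num)
    refine le_trans ?_ h₂
    refine (sq_le_sq₀ (by norm_num) (by positivity)).mp ?_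
    rw [← Real.rpow_natCast (_ ^ _), ← Real.rpow_mul (by norm_num)]
    norm_num
  have h₃ : (9 / 10 : ℝ) ≤ constRho ^ ((1 : ℝ) / 4) := by
    have h₄ : (((9 : ℝ) / 10) ^ 4) ^ ((1 : ℝ) / 4) ≤ constRho ^ ((1 : ℝ) / 4) :=
      Real.rpow_le_rpow (by norm_num) (le_trans (by norm_num) le_constRho) (by norm_num)
    refine le_trans (le_of_eq ?_) h₄
    rw [← Real.rpow_natCast, ← Real.rpow_mul (by norm_num)]
    norm_num
  -- After cancelling d this reads d/4 ≤ 0.12825, and d/4 ≤ 1/8.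
  calc (constD / 2) ^ 2 ≤ 3 / 4 * (19 / 100) * constD * (9 / 10) := by nlinarith
    _ ≤ 3 / 4 * eps 3 ^ ((3 : ℝ) / 2) * constD * constRho ^ ((1 : ℝ) / 4) := by gcongr

lemma constC_pos : 0 < constC :=
  (Real.rpow_pos_of_pos (half_pos constD_pos) _).trans_le rpow_sixteenth_le_constC

lemma log_epsInv_div_le (j : ℕ) :
    Real.log (epsInv (j + 5)) / 2 ^ (j + 5) ≤
      (Real.log (eps 3) - Real.log (constD / 2) + (j + 1) * Real.log 2) / 2 ^ (j + 5) +
        1 / 16 * Real.log (constD / 2) := by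
  have hb := half_pos constD_pos
  have he : 0 < eps 3 := isLeast_eps_three.1.1
  have h := Real.log_le_log (epsInv_pos _) (epsInv_add_five_le j)
  rw [Real.log_mul (by positivity) (by positivity), Real.log_mul (by positivity) (by positivity),
    Real.log_pow, Real.log_pow, Nat.cast_sub Nat.one_le_two_pow] at h
  push_cast at h
  have e : (2 : ℝ) ^ (j + 5) = 16 * 2 ^ (j + 1) := by ring
  rw [div_add' _ _ _ (by positivity)]
  refine div_le_div_of_nonneg_right ?_ (by positivity)
  rw [e]
  linarith

lemma tendsto_log_epsInv_bound :
    Tendsto (fun j : ℕ => (Real.log (eps 3) - Real.log (constD / 2) + (j + 1) * Real.log 2) /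
      2 ^ (j + 5) + 1 / 16 * Real.log (constD / 2)) atTop (𝓝 (1 / 16 * Real.log (constD / 2))) := by
  have h₁ : Tendsto (fun j : ℕ => ((1 : ℝ) / 2) ^ j) atTop (𝓝 0) :=
    tendsto_pow_atTop_nhds_zero_of_lt_one (by norm_num) (by norm_num)
  have h₂ : Tendsto (fun j : ℕ => (j : ℝ) * (1 / 2) ^ j) atTop (𝓝 0) :=
    tendsto_self_mul_const_pow_of_lt_one (by norm_num) (by norm_num)
  have h := ((h₁.const_mul ((Real.log (eps 3) - Real.log (constD / 2) + Real.log 2) / 32)).add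
    (h₂.const_mul (Real.log 2 / 32))).add_const (1 / 16 * Real.log (constD / 2))
  simp only [mul_zero, zero_add] at h
  refine h.congr fun j => ?_
  rw [one_div_pow, pow_add]
  field_simp
  ring

end Constants

/-- The constants `ε_3`, `d` and `ε_k^{inv}` are well defined, and
`log ε_k^{inv} ≤ 2 ^ k * log (C + o(1))` as `k → ∞`. -/
theorem theorem2 :
    IsLeast (admissibleConstants heightA 3) (eps 3) ∧
    IsLUB ternaryRatios constD ∧
    (∀ k : ℕ, IsLeast (admissibleConstants heightC k) (epsInv k)) ∧
    ∃ o : ℕ → ℝ, Tendsto o atTop (𝓝 0) ∧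
      ∀ k : ℕ, 0 < constC + o k ∧
        Real.log (epsInv k) ≤ 2 ^ k * Real.log (constC + o k) := by
  -- With this choice C + o(k) is the larger of (ε_k^inv)^(1/2^k) and C, so positivity and the
  -- inequality hold for every k; only the limit uses the asymptotic bound.
  refine ⟨isLeast_eps_three, isLUB_constD, isLeast_epsInv,
    fun k => max (Real.exp (Real.log (epsInv k) / 2 ^ k)) constC - constC, ?_, fun k => ?_⟩
  · rw [← tendsto_add_atTop_iff_nat 5]
    have hlim := ((Real.continuous_exp.tendsto _).comp tendsto_log_epsInv_bound).max
      (tendsto_const_nhds (x := constC)) |>.sub_const constC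
    have hle : Real.exp (1 / 16 * Real.log (constD / 2)) ≤ constC := by
      rw [mul_comm, Real.exp_mul, Real.exp_log (half_pos constD_pos)]
      exact rpow_sixteenth_le_constC
    rw [max_eq_right hle, sub_self] at hlim
    refine squeeze_zero (fun j => sub_nonneg.mpr (le_max_right _ _)) (fun j => ?_) hlim
    exact sub_le_sub_right (max_le_max_right _ (Real.exp_le_exp.mpr (log_epsInv_div_le j))) _
  · rw [add_sub_cancel]
    refine ⟨lt_max_of_lt_right constC_pos, ?_⟩
    have h := Real.log_le_log (Real.exp_pos _)
      (le_max_left (Real.exp (Real.log (epsInv k) / 2 ^ k)) constC)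
    rw [Real.log_exp, div_le_iff₀ (by positivity)] at h
    rwa [mul_comm]
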